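/- Let $n\ge 2$, let $F_q$ be a finite field of characteristic $p$, let $G=\mathrm{GL}_n(q)$, and let $B$ be the subgroup of upper triangular matrices in $G$. Let $\ell\ne p$ be a prime, and let $R$ be a local principal ideal domain of characteristic $0$ with maximal ideal $\ell R$ that contains a primitive $p$-th root of unity. Put $K=R/\ell R$. Let $I=RG\cdot \mathbf{e}$ be the Steinberg lattice, i.e. the left ideal of $RG$ generated by $$\mathbf{e}=\sum_{\sigma\in S_n}\mathrm{sg}(\sigma)\,\sigma\sum_{b\in B}b ,$$ where $S_n$ is viewed inside $G$ as the group of permutation matrices. Let $f:I\times I\to R$ be the bilinear form obtained by restricting to $I$ the form $(g,h)\mapsto\delta_{g,h}$ on $RG$ and scaling by $1/|B|$ (on $I$ the values of the unscaled form lie in $|B|R$). For each integer $c\ge 0$ let $$I(c)=\{x\in I : f(x,I)\subseteq \ell^cR\},$$ an $RG$-submodule of $I$, and let $$L(c)=(I(c)+\ell I)/\ell I,$$ a $KG$-submodule of $L=I/\ell I$. Theorem A12. For every integer $c\ge 0$: (1) for every $RG$-endomorphism $\varphi$ of $I(c)$ there is $r\in R$ with $\varphi(x)=rx$ for all $x\in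 I(c)$; (2) for every $KG$-endomorphism $\varphi$ of $L(c)$ there is $a\in K$ with $\varphi(x)=ax$ for all $x\in L(c)$. -/

import Mathlib

noncomputable section

namespace Steinberg

/-- The group `G = GL_n(q)`, for `F` the field with `q` elements. -/
abbrev G (n : ℕ) (F : Type*) [Field F] : Type _ := Matrix.GeneralLinearGroup (Fin n) F

/-- The group algebra `RG`. -/
abbrev GroupAlg (n : ℕ) (F R : Type*) [Field F] [CommRing R] : Type _ :=
  MonoidAlgebra R (G n F)

/-- The subgroup `B` of upper triangular invertible matrices. -/
def borel (n : ℕ) (F : Type*) [Field F] : Subgroup (G n F) where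
  carrier := {g | ∀ i j : Fin n, j < i → (g : Matrix (Fin n) (Fin n) F) i j = 0}
  mul_mem' := by
    intro a b ha hb i j hij
    have h := Matrix.BlockTriangular.mul (b := (id : Fin n → Fin n))
      (M := (a : Matrix (Fin n) (Fin n) F)) (N := (b : Matrix (Fin n) (Fin n) F))
      (fun i j h => ha i j h) (fun i j h => hb i j h)
    exact h hij
  one_mem' := by
    intro i j hij
    simp [hij.ne']
  inv_mem' := by
    intro a ha i j hij
    have h := Matrix.blockTriangular_inv_of_blockTriangular (b := (id : Fin n → Fin n))
      (M := (a : Matrix (Fin n) (Fin n) F)) (fun i j h => ha i j h)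
    have h2 := h hij
    rwa [← Matrix.coe_units_inv] at h2

theorem mem_borel {n : ℕ} {F : Type*} [Field F] {g : G n F} :
    g ∈ borel n F ↔ ∀ i j : Fin n, j < i → (g : Matrix (Fin n) (Fin n) F) i j = 0 := Iff.rfl

instance {n : ℕ} {F : Type*} [Field F] : DecidablePred (· ∈ borel n F) :=
  Classical.decPred _

/-- The permutation matrix of `σ`, the matrix with `σ e_j = e_{σ j}`, as an element of `G`. -/
def permGL {n : ℕ} (F : Type*) [Field F] (σ : Equiv.Perm (Fin n)) : G n F :=
  Matrix.GeneralLinearGroup.mkOfDetNeZero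
    (Matrix.of fun i j : Fin n => if i = σ j then (1 : F) else 0)
    (by
      have h : (Matrix.of fun i j : Fin n => if i = σ j then (1 : F) else 0)
          = (σ⁻¹).permMatrix F := by
        ext i j
        have e : i = σ j ↔ j = σ.symm i := by
          rw [eq_comm, ← Equiv.eq_symm_apply]
        simp [Equiv.Perm.permMatrix, PEquiv.toMatrix_apply, Equiv.Perm.inv_def, e, eq_comm]
      rw [h, Matrix.det_permutation]
      rcases Int.units_eq_one_or (Equiv.Perm.sign σ⁻¹) with h | h <;> simp [h])

section GroupAlgebra

variable (n : ℕ) (F : Type*) [Field F] [Fintype F] [DecidableEq F] (R : Type*) [CommRing R]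

/-- The sum of all elements of `B` in the group algebra. -/
def borelSum : GroupAlg n F R := ∑ b : borel n F, MonoidAlgebra.single (b : G n F) 1

/-- The generator `∑_σ sg(σ) σ B̂` of the Steinberg lattice. -/
def generator : GroupAlg n F R :=
  ∑ σ : Equiv.Perm (Fin n),
    ((Equiv.Perm.sign σ : ℤ) : R) • (MonoidAlgebra.single (permGL F σ) 1 * borelSum n F R)

/-- The Steinberg lattice: the left ideal `I` of `RG` generated by `generator`. -/
def lattice : Submodule (GroupAlg n F R) (GroupAlg n F R) :=
  Submodule.span (GroupAlg n F R) {generator n F R}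

variable {n F R}

/-- The canonical symmetric bilinear form on `RG`, given by `(g, h) ↦ δ_{g,h}`. -/
def canonicalForm (x y : GroupAlg n F R) : R := ∑ g : G n F, x.coeff g * y.coeff g

theorem borelSum_mul_single {b : G n F} (hb : b ∈ borel n F) :
    borelSum n F R * MonoidAlgebra.single b 1 = borelSum n F R := by
  unfold borelSum
  rw [Finset.sum_mul]
  simp only [MonoidAlgebra.single_mul_single, mul_one]
  exact Fintype.sum_equiv (Equiv.mulRight (⟨b, hb⟩ : borel n F)) _ _ (fun _ => rfl)

theorem lattice_mul_single {x : GroupAlg n F R} (hx : x ∈ lattice n F R) {b : G n F}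
    (hb : b ∈ borel n F) : x * MonoidAlgebra.single b 1 = x := by
  obtain ⟨a, rfl⟩ := Submodule.mem_span_singleton.1 hx
  rw [smul_eq_mul, mul_assoc]
  congr 1
  unfold generator
  rw [Finset.sum_mul]
  refine Finset.sum_congr rfl fun σ _ => ?_
  rw [smul_mul_assoc, mul_assoc, borelSum_mul_single hb]

theorem lattice_coeff_mul {x : GroupAlg n F R} (hx : x ∈ lattice n F R) (g : G n F) {b : G n F}
    (hb : b ∈ borel n F) : x.coeff (g * b) = x.coeff g := by
  conv_lhs => rw [← lattice_mul_single hx hb]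
  rw [MonoidAlgebra.coeff_mul_single_apply]
  simp

/-- On the Steinberg lattice the canonical form takes values in `|B| R`. -/
theorem card_dvd_canonicalForm {x y : GroupAlg n F R} (hx : x ∈ lattice n F R)
    (hy : y ∈ lattice n F R) :
    ((Fintype.card (borel n F) : ℕ) : R) ∣ canonicalForm x y := by
  classical
  unfold canonicalForm
  rw [Fintype.sum_equiv (Subgroup.groupEquivQuotientProdSubgroup (s := borel n F))
    (fun g => x.coeff g * y.coeff g)
    (fun p => x.coeff p.1.out * y.coeff p.1.out)]
  · rw [Fintype.sum_prod_type]
    simp only [Finset.sum_const, Finset.card_univ, nsmul_eq_mul]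
    rw [← Finset.mul_sum]
    exact Dvd.intro _ rfl
  · intro g
    have h : (QuotientGroup.mk g : G n F ⧸ borel n F).out⁻¹ * g ∈ borel n F :=
      QuotientGroup.eq.1 (QuotientGroup.out_eq' _)
    have e : (Subgroup.groupEquivQuotientProdSubgroup (s := borel n F) g).1
        = QuotientGroup.mk g := rfl
    rw [e, ← lattice_coeff_mul hx (QuotientGroup.mk g : G n F ⧸ borel n F).out h,
      ← lattice_coeff_mul hy (QuotientGroup.mk g : G n F ⧸ borel n F).out h,
      mul_inv_cancel_left]

theorem canonicalForm_add_left (x y z : GroupAlg n F R) :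
    canonicalForm (x + y) z = canonicalForm x z + canonicalForm y z := by
  simp [canonicalForm, add_mul, Finset.sum_add_distrib]

theorem canonicalForm_smul_left (r : R) (x z : GroupAlg n F R) :
    canonicalForm (r • x) z = r * canonicalForm x z := by
  simp [canonicalForm, Finset.mul_sum, mul_assoc]

theorem canonicalForm_comm (x y : GroupAlg n F R) : canonicalForm x y = canonicalForm y x := by
  simp [canonicalForm, mul_comm]

theorem canonicalForm_single_mul (g : G n F) (x y : GroupAlg n F R) :
    canonicalForm (MonoidAlgebra.single g 1 * x) y
      = canonicalForm x (MonoidAlgebra.single g⁻¹ 1 * y) := by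
  unfold canonicalForm
  refine Fintype.sum_equiv (Equiv.mulLeft g⁻¹) _ _ fun h => ?_
  simp [MonoidAlgebra.coeff_single_mul_apply]

end GroupAlgebra

set_option linter.unusedSectionVars false

section Filtration

variable (n : ℕ) (F : Type*) [Field F] [Fintype F] [DecidableEq F]
  (R : Type*) [CommRing R] [IsDomain R] [CharZero R]

variable {n F R} in
/-- The value `f(x, y)`: the element of `R` which multiplied by `|B|` is `canonicalForm x y`. -/
def formValue (x y : lattice n F R) : R := (card_dvd_canonicalForm x.2 y.2).choose

variable {n F R} in
theorem card_mul_formValue (x y : lattice n F R) :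
    ((Fintype.card (borel n F) : ℕ) : R) * formValue x y
      = canonicalForm (x : GroupAlg n F R) (y : GroupAlg n F R) :=
  (card_dvd_canonicalForm x.2 y.2).choose_spec.symm

variable {n F R} in
theorem card_mul_cancel {a b : R} (h : ((Fintype.card (borel n F) : ℕ) : R) * a
    = ((Fintype.card (borel n F) : ℕ) : R) * b) : a = b :=
  mul_left_cancel₀ (Nat.cast_ne_zero.2 Fintype.card_ne_zero) h

/-- The bilinear form `f : I × I → R`, the restriction of the canonical form to `I` scaled by
`1/|B|`. -/
def form : LinearMap.BilinForm R (lattice n F R) :=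
  LinearMap.mk₂ R formValue
    (fun x y z => card_mul_cancel (n := n) (F := F) (by
      rw [mul_add]; simp only [card_mul_formValue]
      exact canonicalForm_add_left _ _ _))
    (fun r x z => card_mul_cancel (n := n) (F := F) (by
      rw [smul_eq_mul, mul_left_comm]; simp only [card_mul_formValue]
      exact canonicalForm_smul_left _ _ _))
    (fun x y z => card_mul_cancel (n := n) (F := F) (by
      rw [mul_add]; simp only [card_mul_formValue]
      rw [canonicalForm_comm, canonicalForm_comm (x : GroupAlg n F R),
        canonicalForm_comm (x : GroupAlg n F R)]
      exact canonicalForm_add_left _ _ _))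
    (fun r x z => card_mul_cancel (n := n) (F := F) (by
      rw [smul_eq_mul, mul_left_comm]; simp only [card_mul_formValue]
      rw [canonicalForm_comm, canonicalForm_comm (x : GroupAlg n F R)]
      exact canonicalForm_smul_left _ _ _))

theorem card_mul_form (x y : lattice n F R) :
    ((Fintype.card (borel n F) : ℕ) : R) * form n F R x y
      = canonicalForm (x : GroupAlg n F R) (y : GroupAlg n F R) :=
  card_mul_formValue x y

theorem form_single_smul (g : G n F) (x y : lattice n F R) :
    form n F R ((MonoidAlgebra.single g 1 : GroupAlg n F R) • x) y
      = form n F R x ((MonoidAlgebra.single g⁻¹ 1 : GroupAlg n F R) • y) :=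
  card_mul_cancel (n := n) (F := F) (by
    simp only [card_mul_form]
    exact canonicalForm_single_mul _ _ _)

variable (l : ℕ)

/-- The term `I(c) = {x ∈ I | f(x, I) ⊆ ℓ^c R}`, an `RG`-submodule of `I`. -/
def latticeFil (c : ℕ) : Submodule (GroupAlg n F R) (lattice n F R) where
  carrier := {x | ∀ y, form n F R x y ∈ Ideal.span {(l : R) ^ c}}
  add_mem' := by
    intro x x' hx hx' y
    rw [map_add, LinearMap.add_apply]
    exact add_mem (hx y) (hx' y)
  zero_mem' := by intro y; simp
  smul_mem' := by
    intro a x hx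
    induction a using MonoidAlgebra.induction_linear with
    | zero => intro y; simp
    | add a b ha hb =>
      intro y
      rw [add_smul, map_add, LinearMap.add_apply]
      exact add_mem (ha y) (hb y)
    | single g r =>
      intro y
      have e : (MonoidAlgebra.single g r : GroupAlg n F R)
          = r • MonoidAlgebra.single g 1 := by simp
      rw [e, smul_assoc, map_smul, LinearMap.smul_apply, form_single_smul]
      exact Ideal.mul_mem_left _ _ (hx _)

/-- The residue ring `K = R/ℓR` (a field when `ℓR` is maximal). -/
abbrev Residue : Type _ := R ⧸ Ideal.span {(l : R)}

open scoped Pointwise in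
/-- The `RG`-submodule `ℓI` of `I`. -/
def lMulLattice : Submodule (GroupAlg n F R) (lattice n F R) :=
  (l : R) • (⊤ : Submodule (GroupAlg n F R) (lattice n F R))

/-- The modular reduction `L = I/ℓI`. -/
def Reduction : Type _ := lattice n F R ⧸ lMulLattice n F R l

instance reductionAddCommGroup : AddCommGroup (Reduction n F R l) :=
  inferInstanceAs (AddCommGroup (lattice n F R ⧸ lMulLattice n F R l))

/-- `L` as an `RG`-module. -/
instance reductionLatticeModule : Module (GroupAlg n F R) (Reduction n F R l) :=
  inferInstanceAs (Module (GroupAlg n F R) (lattice n F R ⧸ lMulLattice n F R l))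

/-- `L` as an `R`-module. -/
instance reductionBaseModule : Module R (Reduction n F R l) :=
  inferInstanceAs (Module R (lattice n F R ⧸ lMulLattice n F R l))

instance reductionBaseTower : IsScalarTower R (GroupAlg n F R) (Reduction n F R l) :=
  inferInstanceAs (IsScalarTower R (GroupAlg n F R) (lattice n F R ⧸ lMulLattice n F R l))

/-- The projection `I → L`. -/
def toReduction : lattice n F R →ₗ[GroupAlg n F R] Reduction n F R l :=
  (lMulLattice n F R l).mkQ

theorem toReduction_surjective : Function.Surjective (toReduction n F R l) :=
  Submodule.mkQ_surjective _

theorem toReduction_eq_zero {x : lattice n F R} :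
    toReduction n F R l x = 0 ↔ x ∈ lMulLattice n F R l :=
  Submodule.Quotient.mk_eq_zero _

theorem toReduction_smul (r : R) (x : lattice n F R) :
    toReduction n F R l (r • x) = r • toReduction n F R l x := rfl

theorem reduction_isTorsionBy : Module.IsTorsionBy R (Reduction n F R l) (l : R) := by
  intro x
  obtain ⟨x, rfl⟩ := toReduction_surjective n F R l x
  rw [← toReduction_smul, toReduction_eq_zero]
  exact Submodule.smul_mem_pointwise_smul _ _ _ trivial

/-- `L` as a `K`-vector space: `(r + ℓR) • x = r • x`. -/
instance reductionModule : Module (Residue R l) (Reduction n F R l) :=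
  (reduction_isTorsionBy n F R l).module

theorem residue_smul (r : R) (x : Reduction n F R l) :
    (Ideal.Quotient.mk (Ideal.span {(l : R)}) r : Residue R l) • x = r • x := rfl

theorem single_smul_comm (g : G n F) (r : R) (x : Reduction n F R l) :
    (MonoidAlgebra.single g 1 : GroupAlg n F R) • r • x
      = r • (MonoidAlgebra.single g 1 : GroupAlg n F R) • x := by
  rw [← algebraMap_smul (GroupAlg n F R) r x, ← algebraMap_smul (GroupAlg n F R) r,
    ← mul_smul, ← mul_smul, Algebra.commutes]

/-- The action of `G` on `L` by `K`-linear maps. -/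
def reductionRep : Representation (Residue R l) (G n F) (Reduction n F R l) where
  toFun g :=
    { toFun := fun x => (MonoidAlgebra.single g 1 : GroupAlg n F R) • x
      map_add' := fun x y => smul_add _ x y
      map_smul' := fun k x => by
        obtain ⟨r, rfl⟩ := Ideal.Quotient.mk_surjective k
        exact single_smul_comm n F R l g r x }
  map_one' := by
    ext x
    exact one_smul (GroupAlg n F R) x
  map_mul' g h := by
    ext x
    change (MonoidAlgebra.single (g * h) 1 : GroupAlg n F R) • x
      = (MonoidAlgebra.single g 1 : GroupAlg n F R) • (MonoidAlgebra.single h 1 : GroupAlg n F R) • x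
    rw [← mul_smul, MonoidAlgebra.single_mul_single, one_mul]

/-- `L` as a `KG`-module. -/
instance reductionGroupModule : Module (GroupAlg n F (Residue R l)) (Reduction n F R l) :=
  Module.compHom _ (reductionRep n F R l).asAlgebraHom.toRingHom

/-- The group algebra element `k g` acts on `L` as `x ↦ k • (g • x)`. -/
theorem single_smul (g : G n F) (k : Residue R l) (x : Reduction n F R l) :
    (MonoidAlgebra.single g k : GroupAlg n F (Residue R l)) • x
      = k • ((MonoidAlgebra.single g 1 : GroupAlg n F R) • x) := by
  change (reductionRep n F R l).asAlgebraHom (MonoidAlgebra.single g k) x = _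
  rw [Representation.asAlgebraHom_single]
  rfl

instance : IsScalarTower (Residue R l) (GroupAlg n F (Residue R l)) (Reduction n F R l) where
  smul_assoc k a x := by
    change (reductionRep n F R l).asAlgebraHom (k • a) x
      = k • (reductionRep n F R l).asAlgebraHom a x
    rw [map_smul, LinearMap.smul_apply]

/-- The term `L(c) = (I(c) + ℓI)/ℓI`, a `KG`-submodule of `L`. -/
def reductionFil (c : ℕ) : Submodule (GroupAlg n F (Residue R l)) (Reduction n F R l) where
  carrier := ((latticeFil n F R l c ⊔ lMulLattice n F R l).map (toReduction n F R l) :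
    Submodule (GroupAlg n F R) (Reduction n F R l))
  add_mem' := fun hx hy => add_mem hx hy
  zero_mem' := zero_mem _
  smul_mem' := by
    intro a x hx
    induction a using MonoidAlgebra.induction_linear with
    | zero => rw [zero_smul]; exact zero_mem _
    | add a b ha hb => rw [add_smul]; exact add_mem ha hb
    | single g k =>
      obtain ⟨r, rfl⟩ := Ideal.Quotient.mk_surjective k
      rw [single_smul, residue_smul]
      exact Submodule.smul_of_tower_mem _ r (Submodule.smul_mem _ _ hx)

end Filtration

end Steinberg

end

noncomputable section

namespace Steinberg

set_option linter.unusedSectionVars false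

/-! ### Unitriangular matrices, elementary matrices and the big Bruhat cell. -/

section Groups

variable {n : ℕ} {F : Type*} [Field F]

/-! Let `U` be the unitriangular group, `ε` the sum of its elements in the group algebra and `𝐞` the
generator of `I`. Two facts make every submodule of `I` or of `L` have only scalar endomorphisms.
First, `ε I` is the cyclic module `R ε𝐞`. Indeed the translates `u𝐞` with `u` in `U` span `I` over
`R` (`lattice_le_unitriangularSpan`), and `εu = ε`. Second, no nonzero `x` has `ε a x = 0` for all
`a`. As `x` is right `B`-invariant, the coefficient of `ε g⁻¹ x` at `1` is `|U|` times that of `x`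
at `g`. In `I` it suffices that `|U| ≠ 0`. In `L`, `|U|` is a power of `p`, hence prime to `ℓ`, so
`ℓ` divides all coefficients of `x`; purity of `I` in `RG` then puts `x` in `ℓI`. Purity holds
because the coordinates of `x` in the `u𝐞` are, up to sign, coefficients of `x` on the big cell. For
a submodule `N` and an endomorphism `φ`, `εN` is cyclic because ideals of the base ring are
principal. Since `φ` commutes with `ε`, it acts on `εN` as some scalar `a`. Then `ε b (φ x - a x) =
0` for all `b`, so `φ x = a x` (`exists_forall_end_eq_smul`). -/

theorem permGL_apply (σ : Equiv.Perm (Fin n)) (i j : Fin n) :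
    (permGL F σ : Matrix (Fin n) (Fin n) F) i j = if i = σ j then 1 else 0 := rfl

theorem coe_mul_permGL_apply (g : G n F) (σ : Equiv.Perm (Fin n)) (i j : Fin n) :
    ((g * permGL F σ : G n F) : Matrix (Fin n) (Fin n) F) i j
      = (g : Matrix (Fin n) (Fin n) F) i (σ j) := by
  rw [Units.val_mul, Matrix.mul_apply]
  simp [permGL_apply]

theorem coe_permGL_mul_apply (g : G n F) (σ : Equiv.Perm (Fin n)) (i j : Fin n) :
    ((permGL F σ * g : G n F) : Matrix (Fin n) (Fin n) F) (σ i) j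
      = (g : Matrix (Fin n) (Fin n) F) i j := by
  rw [Units.val_mul, Matrix.mul_apply]
  simp [permGL_apply]

theorem permGL_mul (σ τ : Equiv.Perm (Fin n)) :
    permGL F (σ * τ) = permGL F σ * permGL F τ := by
  ext i j
  rw [coe_mul_permGL_apply]
  rfl

theorem permGL_one : permGL F (1 : Equiv.Perm (Fin n)) = 1 := by
  ext i j
  rw [permGL_apply, Units.val_one, Matrix.one_apply, Equiv.Perm.one_apply]

theorem permGL_inv (σ : Equiv.Perm (Fin n)) : permGL F σ⁻¹ = (permGL F σ)⁻¹ :=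
  eq_inv_of_mul_eq_one_left (by rw [← permGL_mul, inv_mul_cancel, permGL_one])

theorem coe_permGL_inv_mul_mul_apply (g : G n F) (σ : Equiv.Perm (Fin n)) (i j : Fin n) :
    (((permGL F σ)⁻¹ * g * permGL F σ : G n F) : Matrix (Fin n) (Fin n) F) i j
      = (g : Matrix (Fin n) (Fin n) F) (σ i) (σ j) := by
  rw [coe_mul_permGL_apply, ← permGL_inv]
  simpa using coe_permGL_mul_apply g σ⁻¹ (σ i) (σ j)

theorem coe_mul_apply_diag {g h : G n F} (hg : g ∈ borel n F) (hh : h ∈ borel n F) (i : Fin n) :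
    ((g * h : G n F) : Matrix (Fin n) (Fin n) F) i i
      = (g : Matrix (Fin n) (Fin n) F) i i * (h : Matrix (Fin n) (Fin n) F) i i := by
  rw [Units.val_mul, Matrix.mul_apply]
  refine Finset.sum_eq_single i (fun k _ hk => ?_) (by simp)
  rcases lt_or_gt_of_ne hk with h' | h'
  · rw [hg _ _ h', zero_mul]
  · rw [hh _ _ h', mul_zero]

variable (n F) in
/-- The subgroup of upper unitriangular matrices. -/
def unitriangular : Subgroup (G n F) where
  carrier := {g | g ∈ borel n F ∧ ∀ i, (g : Matrix (Fin n) (Fin n) F) i i = 1}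
  mul_mem' := fun ha hb => ⟨mul_mem ha.1 hb.1, fun i => by
    rw [coe_mul_apply_diag ha.1 hb.1, ha.2, hb.2, one_mul]⟩
  one_mem' := ⟨one_mem _, fun i => by simp⟩
  inv_mem' := fun {a} ha => ⟨inv_mem ha.1, fun i => by
    have h := coe_mul_apply_diag ha.1 (inv_mem ha.1) i
    rw [mul_inv_cancel, ha.2, one_mul] at h
    simpa using h.symm⟩

theorem unitriangular_le_borel : unitriangular n F ≤ borel n F := fun _ h => h.1

/-- By Cayley–Hamilton `(u - 1) ^ n = 0`, and in characteristic `p` this gives `u ^ p ^ n = 1`. -/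
theorem isPGroup_unitriangular (p : ℕ) [Fact p.Prime] [CharP F p] :
    IsPGroup p (unitriangular n F) := by
  rintro ⟨u, hu⟩
  rcases isEmpty_or_nonempty (Fin n) with hn | hn
  · exact ⟨0, Subsingleton.elim _ _⟩
  refine ⟨n, Subtype.ext (Units.ext ?_)⟩
  change (u : Matrix (Fin n) (Fin n) F) ^ p ^ n = 1
  have hc : (u : Matrix (Fin n) (Fin n) F).charpoly = (Polynomial.X - 1) ^ n := by
    rw [Matrix.charpoly_of_isUpperTriangular _ (fun i j h => hu.1 i j h)]
    simp [hu.2]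
  have h0 : ((u : Matrix (Fin n) (Fin n) F) - 1) ^ n = 0 := by
    have h := Matrix.aeval_self_charpoly (u : Matrix (Fin n) (Fin n) F)
    simpa [hc] using h
  have h1 : ((u : Matrix (Fin n) (Fin n) F) - 1) ^ p ^ n = 0 :=
    pow_eq_zero_of_le (Nat.lt_pow_self (Fact.out : p.Prime).one_lt).le h0
  have h2 := add_pow_char_pow_of_commute p n (Commute.one_right ((u : Matrix (Fin n) (Fin n) F) - 1))
  rwa [sub_add_cancel, h1, one_pow, zero_add] at h2

/-- The elementary matrix `1 + c E_{ij}` for `i ≠ j`, as an element of `G`. -/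
def transvectionGL {i j : Fin n} (h : i ≠ j) (c : F) : G n F :=
  Matrix.GeneralLinearGroup.mkOfDetNeZero (Matrix.transvection i j c)
    (by rw [Matrix.det_transvection_of_ne i j h]; exact one_ne_zero)

theorem transvectionGL_apply {i j : Fin n} (h : i ≠ j) (c : F) (a b : Fin n) :
    (transvectionGL h c : Matrix (Fin n) (Fin n) F) a b
      = (if a = b then 1 else 0) + if a = i ∧ b = j then c else 0 := by
  change Matrix.transvection i j c a b = _
  simp [Matrix.transvection, Matrix.one_apply, Matrix.single_apply, eq_comm]

theorem coe_transvectionGL_mul_apply {i j : Fin n} (h : i ≠ j) (c : F) (g : G n F) (a b : Fin n) :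
    ((transvectionGL h c * g : G n F) : Matrix (Fin n) (Fin n) F) a b
      = (g : Matrix (Fin n) (Fin n) F) a b
        + if a = i then c * (g : Matrix (Fin n) (Fin n) F) j b else 0 := by
  rw [Units.val_mul]
  change (Matrix.transvection i j c * (g : Matrix (Fin n) (Fin n) F)) a b = _
  split_ifs with ha
  · subst ha; simp
  · rw [Matrix.transvection_mul_apply_of_ne _ _ _ _ ha, add_zero]

theorem coe_mul_transvectionGL_apply {i j : Fin n} (h : i ≠ j) (c : F) (g : G n F) (a b : Fin n) :
    ((g * transvectionGL h c : G n F) : Matrix (Fin n) (Fin n) F) a b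
      = (g : Matrix (Fin n) (Fin n) F) a b
        + if b = j then c * (g : Matrix (Fin n) (Fin n) F) a i else 0 := by
  rw [Units.val_mul]
  change ((g : Matrix (Fin n) (Fin n) F) * Matrix.transvection i j c) a b = _
  split_ifs with hb
  · subst hb; simp
  · rw [Matrix.mul_transvection_apply_of_ne _ _ _ _ hb, add_zero]

theorem transvectionGL_mem_unitriangular {i j : Fin n} (h : i < j) (c : F) :
    transvectionGL h.ne c ∈ unitriangular n F := by
  refine ⟨fun a b hab => ?_, fun a => ?_⟩
  · rw [transvectionGL_apply, if_neg hab.ne', if_neg, add_zero]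
    rintro ⟨rfl, rfl⟩
    exact lt_asymm h hab
  · rw [transvectionGL_apply, if_pos rfl, if_neg, add_zero]
    rintro ⟨rfl, h'⟩
    exact h.ne h'

theorem permGL_swap_mul_transvectionGL_mul {i j : Fin n} (h : i ≠ j) (c : F) :
    permGL F (Equiv.swap i j) * transvectionGL h c * permGL F (Equiv.swap i j)
      = transvectionGL h.symm c := by
  have e : permGL F (Equiv.swap i j) = (permGL F (Equiv.swap i j))⁻¹ := by
    rw [← permGL_inv, Equiv.swap_inv]
  conv_lhs => rw [e]
  rw [← e]
  nth_rewrite 1 [e]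
  ext a b
  rw [coe_permGL_inv_mul_mul_apply, transvectionGL_apply, transvectionGL_apply]
  congr 1
  · simp
  · have h1 : Equiv.swap i j a = i ↔ a = j := by rw [Equiv.swap_apply_eq_iff, Equiv.swap_apply_left]
    have h2 : Equiv.swap i j b = j ↔ b = i := by rw [Equiv.swap_apply_eq_iff, Equiv.swap_apply_right]
    simp only [h1, h2]

/-- An adjacent transposition moves only the position `(i, j)` from above the diagonal to below it.
-/
theorem swap_mul_mul_swap_mem_unitriangular {i j : Fin n} (hij : (j : ℕ) = i + 1) {u : G n F}
    (hu : u ∈ unitriangular n F) (h0 : (u : Matrix (Fin n) (Fin n) F) i j = 0) :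
    permGL F (Equiv.swap i j) * u * permGL F (Equiv.swap i j) ∈ unitriangular n F := by
  have entry : ∀ a b, ((permGL F (Equiv.swap i j) * u * permGL F (Equiv.swap i j) : G n F) :
      Matrix (Fin n) (Fin n) F) a b
        = (u : Matrix (Fin n) (Fin n) F) (Equiv.swap i j a) (Equiv.swap i j b) := by
    intro a b
    rw [← coe_permGL_inv_mul_mul_apply, ← permGL_inv, Equiv.swap_inv]
  refine ⟨fun a b hab => ?_, fun a => by rw [entry, hu.2]⟩
  rw [entry]
  by_cases h : a = j ∧ b = i
  · rw [h.1, h.2, Equiv.swap_apply_left, Equiv.swap_apply_right, h0]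
  · refine hu.1 _ _ ?_
    simp only [Equiv.swap_apply_def]
    simp only [Fin.ext_iff, Fin.lt_def] at *
    split_ifs <;> omega

theorem isDiag_mul_mul_inv_mem_unitriangular {d u : G n F}
    (hd : (d : Matrix (Fin n) (Fin n) F).IsDiag) (hu : u ∈ unitriangular n F) :
    d * u * d⁻¹ ∈ unitriangular n F := by
  have hdB : d ∈ borel n F := fun i j hij => hd hij.ne'
  refine ⟨mul_mem (mul_mem hdB hu.1) (inv_mem hdB), fun i => ?_⟩
  rw [coe_mul_apply_diag (mul_mem hdB hu.1) (inv_mem hdB), coe_mul_apply_diag hdB hu.1, hu.2,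
    mul_one, ← coe_mul_apply_diag hdB (inv_mem hdB), mul_inv_cancel]
  simp

/-- A submonoid of `G` containing the diagonal matrices, the upper unitriangular matrices and the
permutation matrices of the adjacent transpositions is everything. -/
theorem submonoid_eq_top {m : ℕ} {F : Type*} [Field F] (H : Submonoid (G (m + 1) F))
    (hD : ∀ g : G (m + 1) F, (g : Matrix (Fin (m + 1)) (Fin (m + 1)) F).IsDiag → g ∈ H)
    (hU : ∀ g ∈ unitriangular (m + 1) F, g ∈ H)
    (hS : ∀ i : Fin m, permGL F (Equiv.swap i.castSucc i.succ) ∈ H) : H = ⊤ := by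
  have hP : ∀ σ, permGL F σ ∈ H := by
    intro σ
    have hσ : σ ∈ Submonoid.closure
        (Set.range fun i : Fin m ↦ Equiv.swap i.castSucc i.succ) := by
      rw [Equiv.Perm.mclosure_swap_castSucc_succ]; trivial
    induction hσ using Submonoid.closure_induction with
    | mem x hx => obtain ⟨i, rfl⟩ := hx; exact hS i
    | one => rw [permGL_one]; exact one_mem _
    | mul x y _ _ hx hy => rw [permGL_mul]; exact mul_mem hx hy
  have hT : ∀ (i j : Fin (m + 1)) (h : i ≠ j) (c : F), transvectionGL h c ∈ H := by
    intro i j h c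
    rcases lt_or_gt_of_ne h with h' | h'
    · exact hU _ (transvectionGL_mem_unitriangular h' c)
    · rw [← permGL_swap_mul_transvectionGL_mul h.symm c]
      exact mul_mem (mul_mem (hP _) (hU _ (transvectionGL_mem_unitriangular h' c))) (hP _)
  have key : ∀ A : Matrix (Fin (m + 1)) (Fin (m + 1)) F, A.det ≠ 0 →
      ∀ g : G (m + 1) F, (g : Matrix (Fin (m + 1)) (Fin (m + 1)) F) = A → g ∈ H := by
    intro A hA
    refine Matrix.diagonal_transvection_induction_of_det_ne_zero
      (fun A => ∀ g : G (m + 1) F, (g : Matrix (Fin (m + 1)) (Fin (m + 1)) F) = A → g ∈ H) A hA ?_ ?_ ?_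
    · intro D _ g hg
      exact hD g (hg ▸ Matrix.isDiag_diagonal D)
    · rintro ⟨i, j, h, c⟩ g hg
      have e : g = transvectionGL h c := Units.ext hg
      exact e ▸ hT i j h c
    · intro A B hA hB ihA ihB g hg
      have e : g = Matrix.GeneralLinearGroup.mkOfDetNeZero A hA
          * Matrix.GeneralLinearGroup.mkOfDetNeZero B hB := Units.ext hg
      exact e ▸ mul_mem (ihA _ rfl) (ihB _ rfl)
  refine eq_top_iff.2 fun g _ => key _ ?_ g rfl
  exact ((Matrix.isUnit_iff_isUnit_det _).1 g.isUnit).ne_zero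

/-- Both sides have the same sum over all `i`, so the pointwise inequalities are equalities. -/
theorem perm_eq_rev_of_le (τ : Equiv.Perm (Fin n)) (h : ∀ i, τ i ≤ Fin.rev i) :
    τ = Fin.revPerm := by
  have hs : ∑ i, ((τ i : Fin n) : ℕ) = ∑ i, ((Fin.rev i : Fin n) : ℕ) := by
    rw [Equiv.sum_comp τ (fun i => (i : ℕ))]
    exact (Equiv.sum_comp Fin.revPerm (fun i : Fin n => (i : ℕ))).symm
  have h' := (Finset.sum_eq_sum_iff_of_le (s := Finset.univ)
    (fun i _ => (show ((τ i : Fin n) : ℕ) ≤ ((Fin.rev i : Fin n) : ℕ) from h i))).1 hs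
  exact Equiv.ext fun i => Fin.ext (h' i (Finset.mem_univ i))

/-- In the big Bruhat cell the decomposition `u w₀ = σ b` forces `u = 1`, `σ = w₀`. -/
theorem permGL_inv_mul_mul_permGL_rev_mem_borel {u : G n F} (hu : u ∈ unitriangular n F)
    (σ : Equiv.Perm (Fin n)) :
    (permGL F σ)⁻¹ * u * permGL F Fin.revPerm ∈ borel n F ↔ σ = Fin.revPerm ∧ u = 1 := by
  have entry : ∀ i j, (((permGL F σ)⁻¹ * u * permGL F Fin.revPerm : G n F) :
      Matrix (Fin n) (Fin n) F) i j = (u : Matrix (Fin n) (Fin n) F) (σ i) (Fin.rev j) := by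
    intro i j
    rw [coe_mul_permGL_apply, ← permGL_inv]
    simpa using coe_permGL_mul_apply u σ⁻¹ (σ i) (Fin.rev j)
  constructor
  · intro h
    rw [mem_borel] at h
    simp only [entry] at h
    -- The diagonal entry `u i i = 1` lands in row `σ⁻¹ i` and column `rev i`, which must not be
    -- below the diagonal.
    have hσ : σ⁻¹ = Fin.revPerm := by
      refine perm_eq_rev_of_le _ fun i => ?_
      by_contra hi
      have := h (σ⁻¹ i) (Fin.rev i) (not_le.1 hi)
      simp [hu.2] at this
    have hσ' : σ = Fin.revPerm := by
      rw [← inv_inv σ, hσ]; rfl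
    refine ⟨hσ', ?_⟩
    -- Now `w₀ u w₀` is upper triangular, so `u` is lower as well as upper unitriangular.
    ext i j
    rcases lt_trichotomy i j with hij | rfl | hij
    · have := h (Fin.rev i) (Fin.rev j) (Fin.rev_lt_rev.2 hij)
      rw [hσ', Fin.revPerm_apply, Fin.rev_rev, Fin.rev_rev] at this
      rw [this]; simp [hij.ne]
    · rw [hu.2]; simp
    · rw [hu.1 _ _ hij]; simp [hij.ne']
  · rintro ⟨rfl, rfl⟩
    rw [mul_one, inv_mul_cancel]
    exact one_mem _

end Groups

/-! ### How the torus, transpositions and root subgroups act on the generator. -/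

section Generator

open MonoidAlgebra

theorem single_mul_mul {n : ℕ} {F : Type*} [Field F] {R : Type*} [CommRing R] (g h : G n F)
    (x : GroupAlg n F R) :
    (single (g * h) 1 : GroupAlg n F R) * x = single g 1 * (single h 1 * x) := by
  rw [← mul_assoc, single_mul_single, one_mul]

variable {n : ℕ} {F : Type*} [Field F] [Fintype F] [DecidableEq F] {R : Type*} [CommRing R]

theorem single_mul_borelSum {b : G n F} (hb : b ∈ borel n F) :
    (single b 1 : GroupAlg n F R) * borelSum n F R = borelSum n F R := by
  unfold borelSum
  rw [Finset.mul_sum]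
  simp only [single_mul_single, mul_one]
  exact Fintype.sum_equiv (Equiv.mulLeft (⟨b, hb⟩ : borel n F)) _ _ (fun _ => rfl)

theorem borelSum_coeff (g : G n F) :
    (borelSum n F R).coeff g = if g ∈ borel n F then 1 else 0 := by
  classical
  unfold borelSum
  rw [coeff_sum, Finsupp.finsetSum_apply]
  simp only [coeff_single, Finsupp.single_apply]
  split_ifs with h
  · rw [Finset.sum_eq_single (⟨g, h⟩ : borel n F)]
    · simp
    · intro b _ hb
      exact if_neg fun e => hb (Subtype.ext e)
    · simp
  · exact Finset.sum_eq_zero fun b _ => if_neg fun e : (b : G n F) = g => h (e ▸ b.2)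

/-- If `σ⁻¹ M σ` lies in `B` then `M` fixes `σ B̂`. -/
theorem single_mul_single_permGL_mul_borelSum {M : G n F} {σ : Equiv.Perm (Fin n)}
    (h : ∀ i j, j < i → (M : Matrix (Fin n) (Fin n) F) (σ i) (σ j) = 0) :
    (single M 1 : GroupAlg n F R) * (single (permGL F σ) 1 * borelSum n F R)
      = single (permGL F σ) 1 * borelSum n F R := by
  have hb : (permGL F σ)⁻¹ * M * permGL F σ ∈ borel n F := fun i j hij => by
    rw [coe_permGL_inv_mul_mul_apply, h i j hij]
  have e : M * permGL F σ = permGL F σ * ((permGL F σ)⁻¹ * M * permGL F σ) := by group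
  rw [← single_mul_mul, e, single_mul_mul, single_mul_borelSum hb]

theorem single_mul_generator_of_isDiag {d : G n F}
    (hd : (d : Matrix (Fin n) (Fin n) F).IsDiag) :
    (single d 1 : GroupAlg n F R) * generator n F R = generator n F R := by
  unfold generator
  rw [Finset.mul_sum]
  refine Finset.sum_congr rfl fun σ _ => ?_
  rw [mul_smul_comm, single_mul_single_permGL_mul_borelSum]
  intro i j hij
  exact hd (σ.injective.ne hij.ne')

theorem single_permGL_swap_mul_generator {i j : Fin n} (h : i ≠ j) :
    (single (permGL F (Equiv.swap i j)) 1 : GroupAlg n F R) * generator n F R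
      = -generator n F R := by
  unfold generator
  rw [Finset.mul_sum, ← Finset.sum_neg_distrib]
  refine Fintype.sum_equiv (Equiv.mulLeft (Equiv.swap i j)) _ _ fun σ => ?_
  rw [Equiv.coe_mulLeft, mul_smul_comm, ← single_mul_mul, ← permGL_mul,
    Equiv.Perm.sign_mul, Equiv.Perm.sign_swap h]
  simp

variable (F R) in
/-- The part of the generator indexed by the permutations `σ` with `σ⁻¹ i < σ⁻¹ j`. -/
def halfGenerator (i j : Fin n) : GroupAlg n F R :=
  ∑ σ : Equiv.Perm (Fin n) with σ⁻¹ i < σ⁻¹ j,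
    ((Equiv.Perm.sign σ : ℤ) : R) • (single (permGL F σ) 1 * borelSum n F R)

/-- Left multiplication by the transposition `s = (i j)` swaps the two halves of the alternating sum
and changes the sign, so `𝐞 = (1 - s) y`. -/
theorem generator_eq_halfGenerator_sub {i j : Fin n} (h : i ≠ j) :
    generator n F R = halfGenerator F R i j
      - single (permGL F (Equiv.swap i j)) 1 * halfGenerator F R i j := by
  have hneg : ∀ σ : Equiv.Perm (Fin n),
      ((Equiv.Perm.sign σ : ℤ) : R) • (single (permGL F σ) 1 * borelSum n F R)
        = -(single (permGL F (Equiv.swap i j)) 1 *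
          (((Equiv.Perm.sign (Equiv.swap i j * σ) : ℤ) : R) •
            (single (permGL F (Equiv.swap i j * σ)) 1 * borelSum n F R))) := by
    intro σ
    rw [mul_smul_comm, ← single_mul_mul, ← permGL_mul, ← mul_assoc, Equiv.swap_mul_self, one_mul,
      Equiv.Perm.sign_mul, Equiv.Perm.sign_swap h]
    simp
  have hiff : ∀ σ : Equiv.Perm (Fin n), ¬ σ⁻¹ i < σ⁻¹ j ↔
      (Equiv.swap i j * σ)⁻¹ i < (Equiv.swap i j * σ)⁻¹ j := by
    intro σ
    have hne : σ⁻¹ i ≠ σ⁻¹ j := σ⁻¹.injective.ne h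
    rw [mul_inv_rev, Equiv.swap_inv, Equiv.Perm.mul_apply, Equiv.Perm.mul_apply,
      Equiv.swap_apply_left, Equiv.swap_apply_right, not_lt]
    exact ⟨fun h' => lt_of_le_of_ne h' hne.symm, le_of_lt⟩
  have hsplit : generator n F R = halfGenerator F R i j
      + ∑ σ : Equiv.Perm (Fin n) with ¬ σ⁻¹ i < σ⁻¹ j,
        ((Equiv.Perm.sign σ : ℤ) : R) • (single (permGL F σ) 1 * borelSum n F R) :=
    (Finset.sum_filter_add_sum_filter_not _ _ _).symm
  rw [hsplit, sub_eq_add_neg]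
  refine congrArg (halfGenerator F R i j + ·) ?_
  rw [halfGenerator, Finset.mul_sum, ← Finset.sum_neg_distrib]
  refine Finset.sum_equiv (Equiv.mulLeft (Equiv.swap i j)) (fun σ => ?_) fun σ _ => hneg σ
  simp only [Finset.mem_filter, Finset.mem_univ, true_and, Equiv.coe_mulLeft]
  exact hiff σ

/-- The only possible off-diagonal entry of `M` is at `(i, j)`, and `σ⁻¹ i < σ⁻¹ j` puts it above
the diagonal in `σ⁻¹ M σ`. -/
theorem single_mul_halfGenerator {i j : Fin n} {M : G n F}
    (hM : ∀ a b, a ≠ b → ¬(a = i ∧ b = j) → (M : Matrix (Fin n) (Fin n) F) a b = 0) :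
    (single M 1 : GroupAlg n F R) * halfGenerator F R i j = halfGenerator F R i j := by
  unfold halfGenerator
  rw [Finset.mul_sum]
  refine Finset.sum_congr rfl fun σ hσ => ?_
  rw [mul_smul_comm, single_mul_single_permGL_mul_borelSum]
  intro a b hab
  refine hM _ _ (σ.injective.ne hab.ne') ?_
  rintro ⟨rfl, rfl⟩
  simp only [Finset.mem_filter, Finset.mem_univ, true_and, Equiv.Perm.inv_def,
    Equiv.symm_apply_apply] at hσ
  exact lt_asymm hab hσ

/-- A computation in `GL₂`. Writing `𝐞 = (1 - s) y` and `x(c)` for the elementary matrix, `y` is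
fixed by every `x(d)`, while `s x(c) s y = x(c⁻¹) s y`. Both sides of the claim become `s y - x(c⁻¹)
s y`. -/
theorem single_swap_mul_transvectionGL_mul_generator {i j : Fin n} (h : i ≠ j) {c : F}
    (hc : c ≠ 0) :
    (single (permGL F (Equiv.swap i j) * transvectionGL h c) 1 : GroupAlg n F R)
        * generator n F R
      = single (transvectionGL h c⁻¹) 1 * generator n F R - generator n F R := by
  set s := permGL F (Equiv.swap i j) with hs
  set y := halfGenerator F R i j with hy
  have hx : ∀ d : F, (single (transvectionGL h d) 1 : GroupAlg n F R) * y = y := by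
    intro d
    refine single_mul_halfGenerator fun a b hab hij => ?_
    rw [transvectionGL_apply, if_neg hab, if_neg hij, add_zero]
  have hxi : transvectionGL h (-c⁻¹) * transvectionGL h c⁻¹ = 1 := by
    ext a b
    rw [coe_transvectionGL_mul_apply, transvectionGL_apply, transvectionGL_apply,
      Units.val_one, Matrix.one_apply, if_neg (fun h' : j = i ∧ b = j => h h'.1.symm)]
    by_cases h1 : a = i <;> by_cases h2 : b = j
    · simp [h1, h2, h]
    · simp [h1, h2, Ne.symm h2]
    · simp [h1]
    · simp [h1]
  have hss : s * s = 1 := by rw [hs, ← permGL_mul, Equiv.swap_mul_self, permGL_one]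
  -- On the coordinates `i, j` this product is the upper triangular matrix with rows `(c, 1)` and
  -- `(0, -c⁻¹)`; elsewhere it is the identity.
  have hM : (single (s * transvectionGL h (-c⁻¹) * s * transvectionGL h c * s) 1 :
      GroupAlg n F R) * y = y := by
    refine single_mul_halfGenerator fun a b hab hij => ?_
    rw [hs, permGL_swap_mul_transvectionGL_mul, mul_assoc, coe_transvectionGL_mul_apply,
      coe_mul_permGL_apply, coe_mul_permGL_apply, transvectionGL_apply, transvectionGL_apply]
    rcases eq_or_ne b i with rfl | hbi
    · rw [Equiv.swap_apply_left]
      by_cases h1 : a = j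
      · subst h1; simp [hab, h, hc]
      · simp [h1, hab]
    · rcases eq_or_ne b j with rfl | hbj
      · rw [Equiv.swap_apply_right]
        have : a ≠ i := fun h' => hij ⟨h', rfl⟩
        simp [this, hab]
      · rw [Equiv.swap_apply_of_ne_of_ne hbi hbj]
        simp [hab, hbj, Ne.symm hbi]
  have e1 : s * transvectionGL h c * s
      = transvectionGL h c⁻¹ * s * (s * transvectionGL h (-c⁻¹) * s * transvectionGL h c * s) := by
    have hxi' : transvectionGL h c⁻¹ * transvectionGL h (-c⁻¹) = 1 := mul_eq_one_comm.1 hxi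
    calc s * transvectionGL h c * s
        = (transvectionGL h c⁻¹ * transvectionGL h (-c⁻¹)) * (s * transvectionGL h c * s) := by
          rw [hxi', one_mul]
      _ = transvectionGL h c⁻¹ * (s * s) * (transvectionGL h (-c⁻¹) * s * transvectionGL h c * s) := by
          rw [hss]; simp only [mul_assoc, mul_one]
      _ = _ := by simp only [mul_assoc]
  have e2 : (single (s * transvectionGL h c) 1 : GroupAlg n F R) * (single s 1 * y)
      = single (transvectionGL h c⁻¹) 1 * (single s 1 * y) := by
    rw [← single_mul_mul, e1, single_mul_mul _ _ y, hM, single_mul_mul]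
  have e3 : (single (s * transvectionGL h c) 1 : GroupAlg n F R) * y = single s 1 * y := by
    rw [single_mul_mul, hx]
  rw [generator_eq_halfGenerator_sub h, ← hs, ← hy, mul_sub, mul_sub, e2, e3, hx]
  abel

/-! ### The unitriangular translates of the generator span the lattice. -/

variable (n F R) in
/-- The `R`-span of the translates of the generator by upper unitriangular matrices. -/
def unitriangularSpan : Submodule R (GroupAlg n F R) :=
  Submodule.span R (Set.range fun u : unitriangular n F =>
    (single (u : G n F) 1 : GroupAlg n F R) * generator n F R)

theorem single_mul_generator_mem {u : G n F} (hu : u ∈ unitriangular n F) :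
    (single u 1 : GroupAlg n F R) * generator n F R ∈ unitriangularSpan n F R :=
  Submodule.subset_span ⟨⟨u, hu⟩, rfl⟩

theorem single_mul_mem_unitriangularSpan {g : G n F}
    (h : ∀ u ∈ unitriangular n F,
      (single (g * u) 1 : GroupAlg n F R) * generator n F R ∈ unitriangularSpan n F R)
    {x : GroupAlg n F R} (hx : x ∈ unitriangularSpan n F R) :
    single g 1 * x ∈ unitriangularSpan n F R := by
  induction hx using Submodule.span_induction with
  | mem x hx =>
    obtain ⟨u, rfl⟩ := hx
    rw [← single_mul_mul]
    exact h u u.2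
  | zero => rw [mul_zero]; exact zero_mem _
  | add x y _ _ hx hy => rw [mul_add]; exact add_mem hx hy
  | smul r x _ hx => rw [mul_smul_comm]; exact Submodule.smul_mem _ r hx

/-- Split `u = v x(c)` with `v i j = 0`. Then `s u = (s v s)(s x(c))`, where `s v s` is again
unitriangular and `s x(c) 𝐞` is covered by the rank-one relation. -/
theorem single_swap_mul_generator_mem {i j : Fin n} (hij : (j : ℕ) = i + 1) {u : G n F}
    (hu : u ∈ unitriangular n F) :
    (single (permGL F (Equiv.swap i j) * u) 1 : GroupAlg n F R) * generator n F R
      ∈ unitriangularSpan n F R := by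
  have hlt : i < j := by rw [Fin.lt_def]; omega
  set s := permGL F (Equiv.swap i j) with hs
  set c := (u : Matrix (Fin n) (Fin n) F) i j with hc
  set v := u * (transvectionGL hlt.ne c)⁻¹ with hv
  have hvU : v ∈ unitriangular n F :=
    mul_mem hu (inv_mem (transvectionGL_mem_unitriangular hlt c))
  have huv : u = v * transvectionGL hlt.ne c := by rw [hv, inv_mul_cancel_right]
  have hv0 : (v : Matrix (Fin n) (Fin n) F) i j = 0 := by
    have h := hc
    rw [huv, coe_mul_transvectionGL_apply, if_pos rfl, hvU.2, mul_one] at h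
    exact (add_eq_right.1 h.symm)
  have hss : s * s = 1 := by rw [hs, ← permGL_mul, Equiv.swap_mul_self, permGL_one]
  have hw := swap_mul_mul_swap_mem_unitriangular hij hvU hv0
  rw [← hs] at hw
  have e : s * u = (s * v * s) * (s * transvectionGL hlt.ne c) := by
    rw [huv]
    simp only [mul_assoc]
    rw [← mul_assoc s s, hss, one_mul]
  have key : (single (s * transvectionGL hlt.ne c) 1 : GroupAlg n F R) * generator n F R
      ∈ unitriangularSpan n F R := by
    by_cases h0 : c = 0
    · have : transvectionGL hlt.ne c = 1 := by
        rw [h0]; ext a b; rw [transvectionGL_apply]; simp [Matrix.one_apply]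
      rw [this, mul_one, single_permGL_swap_mul_generator hlt.ne]
      refine neg_mem ?_
      simpa [← one_def] using single_mul_generator_mem (R := R) (one_mem (unitriangular n F))
    · rw [single_swap_mul_transvectionGL_mul_generator hlt.ne h0]
      refine sub_mem (single_mul_generator_mem (transvectionGL_mem_unitriangular hlt _)) ?_
      simpa [← one_def] using single_mul_generator_mem (R := R) (one_mem (unitriangular n F))
  rw [e, single_mul_mul]
  refine single_mul_mem_unitriangularSpan (fun u' hu' => ?_) key
  exact single_mul_generator_mem (mul_mem hw hu')

/-- The span contains `𝐞` and is stable under diagonal matrices, unitriangular matrices and adjacent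
transpositions, which generate `G`. -/
theorem lattice_le_unitriangularSpan {x : GroupAlg n F R} (hx : x ∈ lattice n F R) :
    x ∈ unitriangularSpan n F R := by
  -- Adjacent transpositions are indexed by `Fin m` with `n = m + 1`; for `n = 0` the group is
  -- trivial.
  rcases n with _ | m
  · obtain ⟨a, rfl⟩ := Submodule.mem_span_singleton.1 hx
    induction a using MonoidAlgebra.induction_linear with
    | zero => rw [zero_smul]; exact zero_mem _
    | add a b ha hb =>
      rw [add_smul]
      exact add_mem (ha (Submodule.smul_mem _ _ (Submodule.mem_span_singleton_self _)))
        (hb (Submodule.smul_mem _ _ (Submodule.mem_span_singleton_self _)))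
    | single g r =>
      have e : (single g r : GroupAlg 0 F R) = r • single g 1 := by simp
      rw [e, smul_assoc]
      refine Submodule.smul_mem _ r (single_mul_generator_mem ?_)
      rw [Subsingleton.elim g 1]
      exact one_mem _
  let H : Submonoid (G (m + 1) F) :=
    { carrier := {g | ∀ x ∈ unitriangularSpan (m + 1) F R,
        (single g 1 : GroupAlg (m + 1) F R) * x ∈ unitriangularSpan (m + 1) F R}
      mul_mem' := fun {a b} ha hb x hx => by
        rw [single_mul_mul]
        exact ha _ (hb _ hx)
      one_mem' := fun x hx => by rwa [← one_def, one_mul] }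
  have hH : H = ⊤ := by
    refine submonoid_eq_top H ?_ ?_ ?_
    · intro d hd x hx
      refine single_mul_mem_unitriangularSpan (fun u hu => ?_) hx
      have e : d * u = d * u * d⁻¹ * d := by group
      rw [e, single_mul_mul,
        single_mul_generator_of_isDiag hd]
      exact single_mul_generator_mem (isDiag_mul_mul_inv_mem_unitriangular hd hu)
    · intro v hv x hx
      exact single_mul_mem_unitriangularSpan
        (fun u hu => single_mul_generator_mem (mul_mem hv hu)) hx
    · intro i x hx
      exact single_mul_mem_unitriangularSpan
        (fun u hu => single_swap_mul_generator_mem (by simp) hu) hx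
  obtain ⟨a, rfl⟩ := Submodule.mem_span_singleton.1 hx
  clear hx
  induction a using MonoidAlgebra.induction_linear with
  | zero => rw [zero_smul]; exact zero_mem _
  | add a b ha hb => rw [add_smul]; exact add_mem ha hb
  | single g r =>
    have e : (single g r : GroupAlg (m + 1) F R) = r • single g 1 := by simp
    rw [e, smul_assoc]
    refine Submodule.smul_mem _ r ?_
    have hg : g ∈ H := hH ▸ Submonoid.mem_top g
    refine hg _ ?_
    simpa [← one_def] using single_mul_generator_mem (R := R) (one_mem (unitriangular (m + 1) F))

/-! ### Coordinates on the big cell, and purity. -/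

/-- Only the term `σ = w₀` of `u𝐞` can meet the points `v w₀`, and then only when `u = v`.
Evaluation at these points is thus, up to sign, dual to the family `u𝐞`. -/
theorem single_mul_generator_coeff {u v : G n F} (hu : u ∈ unitriangular n F)
    (hv : v ∈ unitriangular n F) [Decidable (u = v)] :
    ((single u 1 : GroupAlg n F R) * generator n F R).coeff (v * permGL F Fin.revPerm)
      = if u = v then ((Equiv.Perm.sign (Fin.revPerm : Equiv.Perm (Fin n)) : ℤ) : R) else 0 := by
  classical
  rw [coeff_single_mul_apply, one_mul]
  unfold generator
  rw [coeff_sum, Finsupp.finsetSum_apply]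
  have hterm : ∀ σ : Equiv.Perm (Fin n),
      (((Equiv.Perm.sign σ : ℤ) : R) • (single (permGL F σ) 1 * borelSum n F R)).coeff
        (u⁻¹ * (v * permGL F Fin.revPerm))
      = if σ = Fin.revPerm ∧ u⁻¹ * v = 1 then ((Equiv.Perm.sign σ : ℤ) : R) else 0 := by
    intro σ
    rw [coeff_smul, Finsupp.smul_apply, coeff_single_mul_apply, one_mul, borelSum_coeff,
      ← mul_assoc, ← mul_assoc, mul_assoc _ u⁻¹ v]
    simp only [permGL_inv_mul_mul_permGL_rev_mem_borel (mul_mem (inv_mem hu) hv) σ]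
    simp
  simp only [hterm, inv_mul_eq_one]
  split_ifs with h
  · rw [Finset.sum_eq_single Fin.revPerm] <;> simp +contextual [h]
  · simp [h]

instance : Fintype (unitriangular n F) := Fintype.ofFinite _

theorem exists_coeff_of_mem_lattice {x : GroupAlg n F R} (hx : x ∈ lattice n F R) :
    ∃ a : unitriangular n F → R,
      x = ∑ u, a u • ((single (u : G n F) 1 : GroupAlg n F R) * generator n F R) ∧
      ∀ v : unitriangular n F, x.coeff ((v : G n F) * permGL F Fin.revPerm)
        = ((Equiv.Perm.sign (Fin.revPerm : Equiv.Perm (Fin n)) : ℤ) : R) * a v := by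
  classical
  obtain ⟨a, ha⟩ := (Submodule.mem_span_range_iff_exists_fun R).1 (lattice_le_unitriangularSpan hx)
  refine ⟨a, ha.symm, fun v => ?_⟩
  rw [← ha, coeff_sum, Finsupp.finsetSum_apply, Finset.sum_eq_single v]
  · rw [coeff_smul, Finsupp.smul_apply, single_mul_generator_coeff v.2 v.2, if_pos rfl,
      smul_eq_mul, mul_comm]
  · intro u _ huv
    rw [coeff_smul, Finsupp.smul_apply, single_mul_generator_coeff u.2 v.2,
      if_neg (fun h => huv (Subtype.ext h)), smul_zero]
  · simp

/-- The Steinberg lattice is a pure submodule of the group algebra. -/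
theorem exists_smul_eq_of_dvd_coeff {x : GroupAlg n F R} (hx : x ∈ lattice n F R) {r : R}
    (h : ∀ g, r ∣ x.coeff g) : ∃ y ∈ lattice n F R, x = r • y := by
  obtain ⟨a, hxa, ha⟩ := exists_coeff_of_mem_lattice hx
  -- The coordinate `a u` is plus or minus a coefficient of `x`.
  have hr : ∀ u, r ∣ a u := by
    intro u
    have h1 := ha u ▸ h ((u : G n F) * permGL F Fin.revPerm)
    rcases Int.units_eq_one_or (Equiv.Perm.sign (Fin.revPerm : Equiv.Perm (Fin n))) with e | e <;>
      rw [e] at h1 <;> simpa using h1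
  choose b hb using hr
  refine ⟨∑ u, b u • ((single (u : G n F) 1 : GroupAlg n F R) * generator n F R), ?_, ?_⟩
  · refine sum_mem fun u _ => Submodule.smul_of_tower_mem _ (b u) ?_
    exact Submodule.smul_mem _ _ (Submodule.mem_span_singleton_self _)
  · rw [hxa, Finset.smul_sum]
    exact Finset.sum_congr rfl fun u _ => by rw [hb, mul_smul]

end Generator

/-! ### The abstract criterion for scalar endomorphisms. -/

/-- Let `ε` act on the `A`-module `M` with image in the cyclic `S`-module `S E`, and suppose that
no nonzero vector of `M` is killed by `ε A`. Then the endomorphisms of every `A`-submodule of `M`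
are scalar. -/
theorem exists_forall_end_eq_smul {S A M : Type*} [CommRing S] [IsPrincipalIdealRing S] [Ring A]
    [Algebra S A] [AddCommGroup M] [Module S M] [Module A M] [IsScalarTower S A M]
    (ε : A) (E : M) (hE : ∀ x : M, ∃ r : S, ε • x = r • E)
    (hε : ∀ x : M, (∀ a : A, ε • a • x = 0) → x = 0) (N : Submodule A M) (φ : Module.End A N) :
    ∃ r : S, ∀ x, φ x = r • x := by
  have : SMulCommClass A S M := IsScalarTower.to_smulCommClass'
  -- The coordinates of `εN` along `E`; a generator of this ideal gives `x₀` with `εN = S εx₀`.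
  let J : Ideal S :=
    { carrier := {r | ∃ x : N, ε • (x : M) = r • E}
      add_mem' := by
        rintro a b ⟨x, hx⟩ ⟨y, hy⟩
        exact ⟨x + y, by rw [Submodule.coe_add, smul_add, hx, hy, add_smul]⟩
      zero_mem' := ⟨0, by simp⟩
      smul_mem' := by
        rintro s a ⟨x, hx⟩
        exact ⟨s • x, by rw [Submodule.coe_smul_of_tower, smul_comm, hx, smul_assoc]⟩ }
  obtain ⟨r₀, hr₀⟩ := (IsPrincipalIdealRing.principal J).principal
  obtain ⟨x₀, hx₀⟩ : r₀ ∈ J := hr₀ ▸ Submodule.mem_span_singleton_self r₀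
  have cyc : ∀ x : N, ∃ k : S, ε • x = k • ε • x₀ := by
    intro x
    obtain ⟨r, hr⟩ := hE x
    have hrJ : r ∈ J := ⟨x, hr⟩
    rw [hr₀] at hrJ
    obtain ⟨k, rfl⟩ := Submodule.mem_span_singleton.1 hrJ
    refine ⟨k, Subtype.ext ?_⟩
    rw [Submodule.coe_smul, Submodule.coe_smul_of_tower, Submodule.coe_smul, hr, hx₀, smul_assoc]
  have hlin : ∀ (k : S) (x : N), φ (k • x) = k • φ x := by
    intro k x
    rw [← algebraMap_smul A k x, map_smul, algebraMap_smul]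
  -- The scalar is found from `φ (ε x₀) = ε φ(x₀) = a ε x₀`.
  obtain ⟨a, ha⟩ := cyc (φ x₀)
  have hφ : ∀ x : N, φ (ε • x) = a • ε • x := by
    intro x
    obtain ⟨k, hk⟩ := cyc x
    rw [hk, hlin, map_smul, ha, smul_comm]
  refine ⟨a, fun x => sub_eq_zero.1 (Subtype.ext (hε _ fun b => ?_))⟩
  have h : ε • b • (φ x - a • x) = 0 := by
    rw [smul_sub, smul_sub, ← map_smul, ← map_smul, hφ, smul_comm b a x, smul_comm ε a (b • x),
      sub_self]
  exact congrArg Subtype.val h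

/-! ### The unitriangular sum acting on the lattice. -/

section Averaging

open MonoidAlgebra

variable (n : ℕ) (F : Type*) [Field F] [Fintype F] [DecidableEq F] (R : Type*) [CommRing R]

/-- The sum of the upper unitriangular matrices in the group algebra. -/
def unitriangularSum : GroupAlg n F R := ∑ u : unitriangular n F, single (u : G n F) 1

variable {n F R}

theorem unitriangularSum_mul_single {u : G n F} (hu : u ∈ unitriangular n F) :
    unitriangularSum n F R * single u 1 = unitriangularSum n F R := by
  unfold unitriangularSum
  rw [Finset.sum_mul]
  simp only [single_mul_single, mul_one]
  exact Fintype.sum_equiv (Equiv.mulRight (⟨u, hu⟩ : unitriangular n F)) _ _ (fun _ => rfl)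

/-- Since `εu = ε`, applying `ε` to `∑ a_u u𝐞` leaves `(∑ a_u) ε𝐞`. -/
theorem exists_unitriangularSum_mul_eq {x : GroupAlg n F R} (hx : x ∈ lattice n F R) :
    ∃ r : R, unitriangularSum n F R * x = r • (unitriangularSum n F R * generator n F R) := by
  obtain ⟨a, rfl, -⟩ := exists_coeff_of_mem_lattice hx
  refine ⟨∑ u, a u, ?_⟩
  rw [Finset.mul_sum, Finset.sum_smul]
  refine Finset.sum_congr rfl fun u _ => ?_
  rw [mul_smul_comm, ← mul_assoc, unitriangularSum_mul_single u.2]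

/-- Each `u` contributes the coefficient of `x` at `g u⁻¹`, which equals that at `g` by right
`B`-invariance. -/
theorem unitriangularSum_mul_single_mul_coeff {x : GroupAlg n F R} (hx : x ∈ lattice n F R)
    (g : G n F) :
    (unitriangularSum n F R * (single g⁻¹ 1 * x)).coeff 1
      = (Nat.card (unitriangular n F) : R) * x.coeff g := by
  unfold unitriangularSum
  rw [Finset.sum_mul, coeff_sum, Finsupp.finsetSum_apply, Nat.card_eq_fintype_card,
    ← nsmul_eq_mul, ← Finset.card_univ, ← Finset.sum_const]
  refine Finset.sum_congr rfl fun u _ => ?_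
  rw [coeff_single_mul_apply, coeff_single_mul_apply, one_mul, one_mul, inv_inv, mul_one,
    lattice_coeff_mul hx g (unitriangular_le_borel (inv_mem u.2))]

end Averaging

/-! ### Faithfulness of the averaging, integrally and modulo `ℓ`. -/

section Filtration

open MonoidAlgebra

variable {n : ℕ} {F : Type*} [Field F] [Fintype F] [DecidableEq F]
  {R : Type*} [CommRing R] [IsDomain R] [CharZero R]

theorem lattice_eq_zero_of_unitriangularSum_smul (x : lattice n F R)
    (h : ∀ a : GroupAlg n F R, unitriangularSum n F R • a • x = 0) : x = 0 := by
  refine Subtype.ext (MonoidAlgebra.ext (Finsupp.ext fun g => ?_))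
  have h1 := unitriangularSum_mul_single_mul_coeff x.2 g
  have h2 : unitriangularSum n F R * (single g⁻¹ 1 * (x : GroupAlg n F R)) = 0 :=
    congrArg Subtype.val (h (single g⁻¹ 1))
  rw [h2, coeff_zero, Finsupp.zero_apply, eq_comm, mul_eq_zero] at h1
  exact h1.resolve_left (Nat.cast_ne_zero.2 Nat.card_pos.ne')

theorem unitriangularSum_smul_toReduction (l : ℕ) (x : lattice n F R) :
    unitriangularSum n F (Residue R l) • toReduction n F R l x
      = toReduction n F R l (unitriangularSum n F R • x) := by
  unfold unitriangularSum
  rw [Finset.sum_smul, Finset.sum_smul, map_sum]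
  refine Finset.sum_congr rfl fun u _ => ?_
  rw [single_smul, one_smul, map_smul]

theorem mem_lMulLattice {l : ℕ} {x : lattice n F R} :
    x ∈ lMulLattice n F R l ↔ ∃ y : lattice n F R, x = (l : R) • y := by
  unfold lMulLattice
  rw [Submodule.mem_smul_pointwise_iff_exists]
  simp [eq_comm]

/-- For a lift of `x` to `I`, the hypothesis says that `ℓ` divides `|U|` times every coefficient,
hence every coefficient; purity then divides the lift by `ℓ` inside `I`. -/
theorem reduction_eq_zero_of_unitriangularSum_smul {l : ℕ} (hl : Prime (l : R))
    (hU : ¬ (l : R) ∣ (Nat.card (unitriangular n F) : R)) (x : Reduction n F R l)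
    (h : ∀ a : GroupAlg n F (Residue R l), unitriangularSum n F (Residue R l) • a • x = 0) :
    x = 0 := by
  obtain ⟨x, rfl⟩ := toReduction_surjective n F R l x
  have hdvd : ∀ g, (l : R) ∣ (x : GroupAlg n F R).coeff g := by
    intro g
    have h1 := h (single g⁻¹ 1)
    rw [single_smul, one_smul, ← map_smul, unitriangularSum_smul_toReduction,
      toReduction_eq_zero, mem_lMulLattice] at h1
    obtain ⟨y, hy⟩ := h1
    have hy' : unitriangularSum n F R * (single g⁻¹ 1 * (x : GroupAlg n F R))
        = (l : R) • (y : GroupAlg n F R) := congrArg Subtype.val hy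
    have h2 := unitriangularSum_mul_single_mul_coeff x.2 g
    rw [hy', coeff_smul, Finsupp.smul_apply, smul_eq_mul] at h2
    exact (hl.dvd_or_dvd (Dvd.intro _ h2)).resolve_left hU
  obtain ⟨y, hy, hxy⟩ := exists_smul_eq_of_dvd_coeff x.2 hdvd
  rw [toReduction_eq_zero, mem_lMulLattice]
  exact ⟨⟨y, hy⟩, Subtype.ext hxy⟩

/-- `|U|` is a power of `p`, and a Bézout relation between `ℓ` and `p` persists in `R`. -/
theorem not_dvd_card_unitriangular {p l : ℕ} (hp : p.Prime) (hl : l.Prime) (hlp : l ≠ p)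
    [CharP F p] (hlR : Prime (l : R)) : ¬ (l : R) ∣ (Nat.card (unitriangular n F) : R) := by
  have : Fact p.Prime := ⟨hp⟩
  obtain ⟨k, hk⟩ := IsPGroup.iff_card.1 (isPGroup_unitriangular (n := n) (F := F) p)
  rw [hk, Nat.cast_pow]
  intro h
  have hdvd := hlR.dvd_of_dvd_pow h
  have hcop : IsCoprime (l : R) (p : R) := by
    simpa using (Nat.isCoprime_iff_coprime.2 ((Nat.coprime_primes hl hp).2 hlp)).map
      (Int.castRingHom R)
  exact hlR.not_isUnit (hcop.isUnit_of_dvd' dvd_rfl hdvd)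

end Filtration

end Steinberg

end

theorem theoremA12 {n : ℕ} (hn : 2 ≤ n) {p l : ℕ} (hp : p.Prime) (hl : l.Prime) (hlp : l ≠ p)
    {F : Type*} [Field F] [Fintype F] [DecidableEq F] [CharP F p]
    {R : Type*} [CommRing R] [IsDomain R] [IsPrincipalIdealRing R] [IsLocalRing R] [CharZero R]
    (hR : IsLocalRing.maximalIdeal R = Ideal.span {(l : R)})
    (hζ : ∃ ζ : R, IsPrimitiveRoot ζ p) (c : ℕ) :
    (∀ φ : Module.End (Steinberg.GroupAlg n F R) (Steinberg.latticeFil n F R l c),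
      ∃ r : R, ∀ x, φ x = r • x) ∧
    (∀ φ : Module.End (Steinberg.GroupAlg n F (Steinberg.Residue R l))
        (Steinberg.reductionFil n F R l c),
      ∃ a : Steinberg.Residue R l, ∀ x, φ x = a • x) := by
  have hlR : Prime (l : R) := by
    rw [← Ideal.span_singleton_prime (Nat.cast_ne_zero.2 hl.ne_zero), ← hR]
    exact (IsLocalRing.maximalIdeal.isMaximal R).isPrime
  have hE : ∀ x : Steinberg.lattice n F R, ∃ r : R,
      Steinberg.unitriangularSum n F R • x
        = r • Steinberg.unitriangularSum n F R •
          (⟨Steinberg.generator n F R, Submodule.mem_span_singleton_self _⟩ :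
            Steinberg.lattice n F R) := fun x => by
    obtain ⟨r, hr⟩ := Steinberg.exists_unitriangularSum_mul_eq x.2
    exact ⟨r, Subtype.ext hr⟩
  refine ⟨Steinberg.exists_forall_end_eq_smul _ _ hE
    Steinberg.lattice_eq_zero_of_unitriangularSum_smul _, ?_⟩
  -- The criterion is now applied over `K`, with `E` the image of `ε𝐞` in `L`.
  have : IsPrincipalIdealRing (Steinberg.Residue R l) :=
    IsPrincipalIdealRing.of_surjective (Ideal.Quotient.mk _) Ideal.Quotient.mk_surjective
  refine Steinberg.exists_forall_end_eq_smul (Steinberg.unitriangularSum n F _)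
    (Steinberg.toReduction n F R l (Steinberg.unitriangularSum n F R •
      ⟨Steinberg.generator n F R, Submodule.mem_span_singleton_self _⟩)) ?_
    (Steinberg.reduction_eq_zero_of_unitriangularSum_smul hlR
      (Steinberg.not_dvd_card_unitriangular hp hl hlp hlR)) _
  intro x
  obtain ⟨x, rfl⟩ := Steinberg.toReduction_surjective n F R l x
  obtain ⟨r, hr⟩ := hE x
  refine ⟨Ideal.Quotient.mk _ r, ?_⟩
  rw [Steinberg.unitriangularSum_smul_toReduction, hr, Steinberg.toReduction_smul,
    Steinberg.residue_smul]
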